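/- Let $d\ge 1$, let $\Omega\subseteq\mathbb R^d$ be open and convex, let $q\in\mathbb N_{\ge 0}$, $m_q=\binom{q+d}{d}$, and let $k:\Omega\times\Omega\to\mathbb R$ be a kernel that is $q+1$ asymptotically smooth: the partial derivatives $\partial_x^{\alpha}\partial_y^{\beta}k$ with $|\alpha|,|\beta|\le q+1$ exist and are continuous off the diagonal, and there are constants $c,r>0$ with $|\partial_x^{\alpha}\partial_y^{\beta}k(x,y)|\le c\,|\alpha+\beta|!\,(r\|x-y\|_2)^{-|\alpha+\beta|}$ for all $x\ne y$ in $\Omega$ and all such $\alpha,\beta$. Let $C_1>0$. Then there is a constant $C>0$, depending only on $\Omega$ (with $d$ and $C_1$), $k$ and $q$, such that the following holds for every $N\ge 2$, every set $X_N=\{x_1,\dots,x_N\}\subset\Omega$ of $N$ distinct points with separation radius $q_{X_N}=\frac12\min_{i\ne j}\|x_i-x_j\|_2\ge C_1N^{-1/d}$, and every $\eta>0$. Let $\mathcal T$ be a binary cluster tree with root $X_N$ in which every cluster $v$ that has sons is split at a median along a longest edge of its bounding box $B_v$ (the smallest axis-parallel box containing $v$) into two disjoint non-empty sons whose cardinalities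 differ by at most one, and in which every leaf has at most $m_q$ points. Write an element $\sum_i\omega_i\delta_{x_i}$ of the span of the point evaluations as its coefficient vector $\omega\in\mathbb R^N$. A leaf $v$ has the scaling functions $\delta_x$, $x\in v$, and no samplets. For a cluster $v$ with sons let $\Phi$ be the row of the $n$ scaling functions of its two sons and $M=[(z^{\alpha},\Phi)]_{|\alpha|\le q}\in\mathbb R^{m_q\times n}$ its moment matrix (rows in any order); take any QR decomposition $M^{T}=QR$ with $Q\in\mathbb R^{n\times n}$ orthogonal and $R\in\mathbb R^{n\times m_q}$ upper triangular; the first $m_q$ entries of the row $\Phi Q$ (all of them if $n\le m_q$) are the scaling functions of $v$, and the remaining entries are the samplets of $v$. Let $\sigma_1,\dots,\sigma_N$, in any order, be the samplet basis, consisting of the scaling functions of the root $X_N$ and all samplets of all clusters, let $\omega_j$ be the coefficient vector of $\sigma_j$, and let $v_j$ be the cluster that provides $\sigma_j$. Put $$K^{\Sigma}=\big[(k,\sigma_j\otimes\sigma_{j'})\big]_{j,j'=1}^N,\qquad (k,\sigma_j\otimes\sigma_{j'})=\sum_{a,b=1}^N\omega_{j,a}\,\omega_{j',b}\,k(x_a,x_b),$$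 and let $K^{\Sigma}_\eta$ arise from $K^{\Sigma}$ by setting to zero every entry $(j,j')$ whose clusters satisfy the admissibility condition $$\operatorname{dist}(B_{v_j},B_{v_{j'}})\ge\eta\,\max\{\operatorname{diam}(B_{v_j}),\operatorname{diam}(B_{v_{j'}})\}.$$ Then $$\|K^{\Sigma}-K^{\Sigma}_\eta\|_F\le C\,\eta^{-2(q+1)}\,N\,\sqrt{\log N}.$$ -/

import Mathlib

namespace Samplet

/-- The ambient Euclidean space `ℝ^d`. -/
abbrev E (d : ℕ) : Type := EuclideanSpace ℝ (Fin d)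

/-! ### Kernels -/

/-- `D α β` is the mixed partial derivative `∂_x^α ∂_y^β k` for all multi-indices with
`|α|, |β| ≤ m`, existing and continuous at all pairs of distinct points of the open set `Ω`. -/
structure IsPartials {d : ℕ} (Ω : Set (E d)) (m : ℕ) (k : E d → E d → ℝ)
    (D : (Fin d → ℕ) → (Fin d → ℕ) → E d → E d → ℝ) : Prop where
  zero : ∀ x ∈ Ω, ∀ y ∈ Ω, x ≠ y → D 0 0 x y = k x y
  fst : ∀ α β : Fin d → ℕ, ∑ i, α i < m → ∑ i, β i ≤ m → ∀ i : Fin d,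
    ∀ x ∈ Ω, ∀ y ∈ Ω, x ≠ y →
      HasLineDerivAt ℝ (fun z => D α β z y) (D (α + Pi.single i 1) β x y) x
        (EuclideanSpace.single i 1)
  snd : ∀ α β : Fin d → ℕ, ∑ i, α i ≤ m → ∑ i, β i < m → ∀ i : Fin d,
    ∀ x ∈ Ω, ∀ y ∈ Ω, x ≠ y →
      HasLineDerivAt ℝ (fun z => D α β x z) (D α (β + Pi.single i 1) x y) y
        (EuclideanSpace.single i 1)
  cont : ∀ α β : Fin d → ℕ, ∑ i, α i ≤ m → ∑ i, β i ≤ m →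
    ContinuousOn (fun p : E d × E d => D α β p.1 p.2)
      {p : E d × E d | p.1 ∈ Ω ∧ p.2 ∈ Ω ∧ p.1 ≠ p.2}

/-- The kernel `k` is `m` asymptotically smooth on the open set `Ω`: its partial derivatives
with `|α|, |β| ≤ m` satisfy `|∂_x^α ∂_y^β k(x, y)| ≤ C |α + β|! / (r ‖x - y‖)^|α + β|`
off the diagonal. -/
def IsAsymptoticallySmooth {d : ℕ} (Ω : Set (E d)) (m : ℕ) (k : E d → E d → ℝ) : Prop :=
  ∃ D : (Fin d → ℕ) → (Fin d → ℕ) → E d → E d → ℝ, IsPartials Ω m k D ∧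
    ∃ C > (0 : ℝ), ∃ r > (0 : ℝ), ∀ α β : Fin d → ℕ, ∑ i, α i ≤ m → ∑ i, β i ≤ m →
      ∀ x ∈ Ω, ∀ y ∈ Ω, x ≠ y →
        |D α β x y| ≤ C * ((∑ i, (α i + β i)).factorial : ℝ)
          / (r * ‖x - y‖) ^ (∑ i, (α i + β i))

/-! ### Point sets and clusters

A family of points is a map `x : Fin N → E d`; a cluster is a set of indices. -/

/-- Separation radius: half of the smallest distance between two distinct points. -/
noncomputable def separationRadius {d N : ℕ} (x : Fin N → E d) : ℝ :=
  (Set.range x).infsep / 2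

/-- Smallest `i`-th coordinate among the points of the cluster `v`. -/
noncomputable def lo {d N : ℕ} (x : Fin N → E d) (v : Finset (Fin N)) (i : Fin d) : ℝ :=
  sInf ((fun a => x a i) '' (v : Set (Fin N)))

/-- Largest `i`-th coordinate among the points of the cluster `v`. -/
noncomputable def hi {d N : ℕ} (x : Fin N → E d) (v : Finset (Fin N)) (i : Fin d) : ℝ :=
  sSup ((fun a => x a i) '' (v : Set (Fin N)))

/-- The bounding box of a cluster. -/
def boundingBox {d N : ℕ} (x : Fin N → E d) (v : Finset (Fin N)) : Set (E d) :=
  {z | ∀ i, lo x v i ≤ z i ∧ z i ≤ hi x v i}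

/-- Distance between two sets. -/
noncomputable def setDist {d : ℕ} (A B : Set (E d)) : ℝ :=
  sInf (Set.image2 dist A B)

/-- The admissibility condition for a pair of clusters. -/
def Admissible {d N : ℕ} (x : Fin N → E d) (η : ℝ) (v w : Finset (Fin N)) : Prop :=
  η * max (Metric.diam (boundingBox x v)) (Metric.diam (boundingBox x w))
    ≤ setDist (boundingBox x v) (boundingBox x w)

/-! ### Cluster trees -/

/-- Binary trees of clusters; the cluster of an inner node is the union of its sons. -/
inductive ClusterTree (N : ℕ) : Type
  | leaf (v : Finset (Fin N)) : ClusterTree N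
  | node (left right : ClusterTree N) : ClusterTree N

/-- The cluster at the root of a tree. -/
def ClusterTree.cluster {N : ℕ} : ClusterTree N → Finset (Fin N)
  | .leaf v => v
  | .node left right => left.cluster ∪ right.cluster

/-- `v₁` and `v₂` arise from the cluster `v₁ ∪ v₂` by a median split along a longest edge of
its bounding box: they are non-empty and disjoint, their cardinalities differ by at most one,
and `v₁` lies on the upper, `v₂` on the lower side of the cut. -/
def IsMedianSplit {d N : ℕ} (x : Fin N → E d) (v₁ v₂ : Finset (Fin N)) : Prop :=
  v₁.Nonempty ∧ v₂.Nonempty ∧ Disjoint v₁ v₂ ∧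
  v₁.card ≤ v₂.card + 1 ∧ v₂.card ≤ v₁.card + 1 ∧
  ∃ l : Fin d,
    (∀ i, hi x (v₁ ∪ v₂) i - lo x (v₁ ∪ v₂) i ≤ hi x (v₁ ∪ v₂) l - lo x (v₁ ∪ v₂) l) ∧
    ∀ a ∈ v₁, ∀ b ∈ v₂, x b l ≤ x a l

/-- Every inner node is a median split along a longest edge, and every leaf has at most `τ`
points. -/
def IsBalancedTree {d N : ℕ} (x : Fin N → E d) (τ : ℕ) : ClusterTree N → Prop
  | .leaf v => v.card ≤ τ
  | .node left right => IsMedianSplit x left.cluster right.cluster ∧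
      IsBalancedTree x τ left ∧ IsBalancedTree x τ right

/-! ### Samplets

The element `∑ i, ω i • δ_{x i}` of the span of the point evaluations is represented by its
coefficient vector `ω : Fin N → ℝ`. -/

/-- Multi-indices of order at most `q`. -/
abbrev MultiIndex (d q : ℕ) : Type := {α : Fin d → ℕ // ∑ i, α i ≤ q}

/-- The dimension `m_q` of the space of polynomials of total degree at most `q`. -/
def mq (d q : ℕ) : ℕ := (q + d).choose d

/-- The moment `(z^α, ω)` of a functional with coefficient vector `ω`. -/
noncomputable def moment {d N : ℕ} (x : Fin N → E d) (α : Fin d → ℕ) (ω : Fin N → ℝ) : ℝ :=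
  ∑ a, ω a * ∏ i, (x a i) ^ (α i)

/-- The moment matrix of a list of functionals, with rows in the order given by `e`. -/
noncomputable def momentMatrix {d N q : ℕ} (x : Fin N → E d)
    (e : Fin (mq d q) ≃ MultiIndex d q) (L : List (Fin N → ℝ)) :
    Matrix (Fin (mq d q)) (Fin L.length) ℝ :=
  Matrix.of fun r c => moment x (e r).1 (L.get c)

/-- `L'` is the row `L * Q`, where `Mᵀ = Q * R` is a QR decomposition of the transpose of the
moment matrix `M` of `L` (`Q` orthogonal, `R` upper triangular). -/
def IsQRTransform {d N : ℕ} (x : Fin N → E d) (q : ℕ) (L L' : List (Fin N → ℝ)) : Prop :=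
  ∃ (e : Fin (mq d q) ≃ MultiIndex d q)
    (Q : Matrix (Fin L.length) (Fin L.length) ℝ) (R : Matrix (Fin L.length) (Fin (mq d q)) ℝ),
    Q ∈ Matrix.orthogonalGroup (Fin L.length) ℝ ∧
    (∀ (i : Fin L.length) (j : Fin (mq d q)), (j : ℕ) < (i : ℕ) → R i j = 0) ∧
    (momentMatrix x e L).transpose = Q * R ∧
    L' = List.ofFn fun c => ∑ i, Q i c • L.get i

/-- `SampletConstruction x q T Φ S`: the recursive construction on the tree `T` returns the
scaling functions `Φ` of the root of `T` and the list `S` of all samplets of the clusters of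
`T`, each paired with the cluster that provides it. A leaf provides its point evaluations and no
samplets; an inner node applies a QR transform to the scaling functions of its two sons, keeps
the first `m_q` results as scaling functions and provides the others as samplets. -/
inductive SampletConstruction {d N : ℕ} (x : Fin N → E d) (q : ℕ) :
    ClusterTree N → List (Fin N → ℝ) → List (Finset (Fin N) × (Fin N → ℝ)) → Prop
  | leaf (v : Finset (Fin N)) (l : List (Fin N)) (hl : l.Nodup) (hv : l.toFinset = v) :
      SampletConstruction x q (.leaf v) (l.map fun a => Pi.single a 1) []
  | node (left right : ClusterTree N) (Φ₁ Φ₂ L : List (Fin N → ℝ))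
      (S₁ S₂ : List (Finset (Fin N) × (Fin N → ℝ)))
      (h₁ : SampletConstruction x q left Φ₁ S₁) (h₂ : SampletConstruction x q right Φ₂ S₂)
      (hL : IsQRTransform x q (Φ₁ ++ Φ₂) L) :
      SampletConstruction x q (.node left right) (L.take (mq d q))
        ((L.drop (mq d q)).map (fun ω => ((ClusterTree.node left right).cluster, ω)) ++ S₁ ++ S₂)

/-- `σ 0, …, σ (N - 1)` is, in some order, a samplet basis for the tree `T` (the scaling
functions of the root together with all samplets), and `v j` is the cluster of `σ j`. -/
def IsSampletBasis {d N : ℕ} (x : Fin N → E d) (q : ℕ) (T : ClusterTree N)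
    (v : Fin N → Finset (Fin N)) (σ : Fin N → Fin N → ℝ) : Prop :=
  ∃ (Φ : List (Fin N → ℝ)) (S : List (Finset (Fin N) × (Fin N → ℝ))),
    SampletConstruction x q T Φ S ∧
    (List.ofFn fun j => (v j, σ j)).Perm (Φ.map (fun ω => (T.cluster, ω)) ++ S)

/-! ### Kernel matrices -/

/-- The kernel matrix in samplet representation, with entries `(k, σ_j ⊗ σ_j')`. -/
noncomputable def sampletKernelMatrix {d N : ℕ} (x : Fin N → E d) (k : E d → E d → ℝ)
    (σ : Fin N → Fin N → ℝ) : Matrix (Fin N) (Fin N) ℝ :=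
  Matrix.of fun j j' => ∑ a, ∑ b, σ j a * σ j' b * k (x a) (x b)

open Classical in
/-- The compressed matrix: entries whose pair of clusters is admissible are set to zero. -/
noncomputable def compressedMatrix {d N : ℕ} (x : Fin N → E d) (k : E d → E d → ℝ) (η : ℝ)
    (v : Fin N → Finset (Fin N)) (σ : Fin N → Fin N → ℝ) : Matrix (Fin N) (Fin N) ℝ :=
  Matrix.of fun j j' =>
    if Admissible x η (v j) (v j') then 0 else sampletKernelMatrix x k σ j j'

section

attribute [local instance] Matrix.frobeniusNormedAddCommGroup

/-- The Frobenius norm. -/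
noncomputable def frobeniusNorm {N : ℕ} (A : Matrix (Fin N) (Fin N) ℝ) : ℝ := ‖A‖

end

end Samplet

namespace Samplet

open Filter Topology

/-! ### Line derivatives from continuous partial derivatives -/

/-! Write `ℓ(v)` for the longest edge of the bounding box of `v`. Samplets annihilate polynomials of
degree at most `q`, so Taylor expansion of `k` in both variables bounds an admissible entry, up to a
constant, by `‖ω‖₁ ‖ω'‖₁ (ℓ(v) ℓ(w))^(q+1) / dist^(2(q+1))`. The coefficient vectors are
orthonormal, whence `‖ω‖₁² ≤ |v|`, and admissibility gives `dist ≥ η max(ℓ(v), ℓ(w))`. The squared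
entry is therefore at most a constant times `η^(-4(q+1)) |v| |w| min ℓ / max ℓ`
(`exists_sq_entry_le`); the first power of the ratio suffices. The root meets every cluster, so it
belongs to no admissible pair and only samplets matter.

It remains to sum `|v| |w| min ℓ / max ℓ` over all pairs, admissible or not. Fix `w` and put `s =
ℓ(w)`. The sum of `|v| ℓ(v)` over the clusters with `ℓ(v) ≤ s` is `O(N s)`, without a logarithm
(`nodeSum_thresholdWeight_le`): cutting a longest edge lowers the potential `|v| · (sum of the
edges)` by a fixed fraction of `|v| ℓ(v)`, so the sum telescopes in every subtree whose root box has
edges at most `s`. Dividing by `s` leaves the sum of `|w|` over the tree, which is `O(N log N)`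
because the tree has logarithmic depth (`nodeSum_card_le`). The squared Frobenius norm is thus `O(N²
log N)`. -/

theorem hasLineDerivAt_add_smul {V : Type*} [NormedAddCommGroup V] [NormedSpace ℝ V]
    {f f' : V → ℝ} {x u v : V} {A c : ℝ} (hu : HasLineDerivAt ℝ f A x u)
    (hv : ∀ᶠ z in 𝓝 x, HasLineDerivAt ℝ f (f' z) z v) (hc : ContinuousAt f' x) :
    HasLineDerivAt ℝ f (A + c * f' x) x (u + c • v) := by
  rw [hasLineDerivAt_iff_isLittleO_nhds_zero] at hu ⊢
  -- Mean value inequality on the segment from `x + t u` to `x + t (u + c v)`. Only derivatives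
  -- along `v` near `x` are needed there, and continuity of `f'` at `x` makes the error `o(t)`.
  have hdiff : (fun t : ℝ => f (x + t • (u + c • v)) - f (x + t • u) - t • (c * f' x))
      =o[𝓝 0] fun t : ℝ => t := by
    rw [Asymptotics.isLittleO_iff]
    intro ε hε
    -- The summand `1` covers `c = 0`.
    set δ := ε / (|c| + 1) with hδ
    have hδ0 : 0 < δ := by positivity
    have hnear : ∀ᶠ z in 𝓝 x, HasLineDerivAt ℝ f (f' z) z v ∧ ‖f' z - f' x‖ ≤ δ := by
      refine hv.and ?_
      have := Metric.tendsto_nhds.1 hc δ hδ0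
      filter_upwards [this] with z hz
      rw [dist_eq_norm] at hz
      exact hz.le
    obtain ⟨ρ, hρ, hball⟩ := Metric.eventually_nhds_iff.1 hnear
    have hsmall : ∀ᶠ t : ℝ in 𝓝 0, |t| * (‖u‖ + |c| * ‖v‖) < ρ := by
      have : Tendsto (fun t : ℝ => |t| * (‖u‖ + |c| * ‖v‖)) (𝓝 0) (𝓝 0) := by
        have h : Continuous fun t : ℝ => |t| * (‖u‖ + |c| * ‖v‖) := by fun_prop
        simpa using h.tendsto 0
      exact this.eventually (gt_mem_nhds hρ)
    filter_upwards [hsmall] with t ht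
    have hpt : ∀ s ∈ Set.Icc (0 : ℝ) 1,
        dist (x + t • u + (s * (t * c)) • v) x < ρ := by
      intro s hs
      rw [dist_eq_norm]
      refine lt_of_le_of_lt ?_ ht
      calc ‖x + t • u + (s * (t * c)) • v - x‖ = ‖t • u + (s * (t * c)) • v‖ := by
            congr 1; abel
        _ ≤ ‖t • u‖ + ‖(s * (t * c)) • v‖ := norm_add_le _ _
        _ = |t| * ‖u‖ + s * (|t| * |c| * ‖v‖) := by
            rw [norm_smul, norm_smul, Real.norm_eq_abs, Real.norm_eq_abs, abs_mul, abs_mul,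
              abs_of_nonneg hs.1]
            ring
        _ ≤ |t| * ‖u‖ + 1 * (|t| * |c| * ‖v‖) := by
            gcongr
            exact hs.2
        _ = _ := by ring
    have hder : ∀ s ∈ Set.Icc (0 : ℝ) 1,
        HasDerivAt (fun s : ℝ => f (x + t • u + (s * (t * c)) • v) - s * ((t * c) * f' x))
          ((t * c) * (f' (x + t • u + (s * (t * c)) • v) - f' x)) s := by
      intro s hs
      have h1 : HasDerivAt (fun r : ℝ => f (x + t • u + (s * (t * c)) • v + r • v))
          (f' (x + t • u + (s * (t * c)) • v)) ((s - s) * (t * c)) := by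
        have := (hball (hpt s hs)).1
        simpa [HasLineDerivAt] using this
      have h2 : HasDerivAt (fun r : ℝ => (r - s) * (t * c)) (t * c) s := by
        simpa using ((hasDerivAt_id s).sub_const s).mul_const (t * c)
      have h3 := h1.scomp s h2
      have h4 : HasDerivAt (fun r : ℝ => r * ((t * c) * f' x)) ((t * c) * f' x) s := by
        simpa using (hasDerivAt_id s).mul_const ((t * c) * f' x)
      have h5 := h3.sub h4
      refine (h5.congr_of_eventuallyEq (.of_forall fun r => ?_)).congr_deriv ?_
      · simp only [Pi.sub_apply, Function.comp]
        rw [add_assoc _ ((s * (t * c)) • v), ← add_smul, ← add_mul, add_sub_cancel]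
      · simp only [smul_eq_mul]; ring
    have hmv := Convex.norm_image_sub_le_of_norm_hasDerivWithin_le
      (C := |t * c| * δ)
      (fun s hs => (hder s hs).hasDerivWithinAt) (fun s hs => by
        rw [norm_mul, Real.norm_eq_abs]
        gcongr
        exact (hball (hpt s hs)).2) (convex_Icc (0 : ℝ) 1)
      (Set.left_mem_Icc.2 zero_le_one) (Set.right_mem_Icc.2 zero_le_one)
    have e1 : x + t • (u + c • v) = x + t • u + ((1 : ℝ) * (t * c)) • v := by
      rw [one_mul, smul_add, smul_smul, add_assoc]
    calc ‖f (x + t • (u + c • v)) - f (x + t • u) - t • (c * f' x)‖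
        ≤ |t * c| * δ * ‖(1 : ℝ) - 0‖ := by
          refine le_trans (le_of_eq ?_) hmv
          rw [e1]
          congr 1
          simp only [zero_mul, zero_smul, add_zero, smul_eq_mul]
          ring
      _ = |c| / (|c| + 1) * (ε * ‖t‖) := by
          rw [abs_mul, hδ]; simp only [sub_zero, norm_one, Real.norm_eq_abs]; field_simp
      _ ≤ 1 * (ε * ‖t‖) := by
          gcongr
          rw [div_le_one (by positivity)]
          linarith
      _ = ε * ‖t‖ := one_mul _
  refine (hu.add hdiff).congr_left fun t => ?_
  simp only [smul_eq_mul]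
  ring

/-- A function on an open set whose partial derivatives are continuous has a derivative in every
direction, given by the usual linear combination. -/
theorem hasLineDerivAt_of_partials {d : ℕ} {U : Set (E d)} (hU : IsOpen U) {f : E d → ℝ}
    {f' : Fin d → E d → ℝ}
    (hf : ∀ i, ∀ z ∈ U, HasLineDerivAt ℝ f (f' i z) z (EuclideanSpace.single i 1))
    (hc : ∀ i, ContinuousOn (f' i) U) {z : E d} (hz : z ∈ U) (h : E d) :
    HasLineDerivAt ℝ f (∑ i, h i * f' i z) z h := by
  have key : ∀ s : Finset (Fin d), HasLineDerivAt ℝ f (∑ i ∈ s, h i * f' i z) z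
      (∑ i ∈ s, h i • EuclideanSpace.single i (1 : ℝ)) := by
    intro s
    induction s using Finset.induction_on with
    | empty => simpa [HasLineDerivAt] using hasDerivAt_const (0 : ℝ) (f z)
    | insert i s hi ih =>
      rw [Finset.sum_insert hi, Finset.sum_insert hi, add_comm, add_comm (h i • _)]
      refine hasLineDerivAt_add_smul ih ?_ ((hc i).continuousAt (hU.mem_nhds hz))
      filter_upwards [hU.mem_nhds hz] with w hw using hf i w hw
  have hh : h = ∑ i, h i • EuclideanSpace.single i (1 : ℝ) := by
    ext j
    simp [Pi.single_apply]
  have := key Finset.univ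
  rwa [← hh] at this

/-! ### Taylor expansion -/

/-- The derivative of a Taylor remainder is the remainder, one order lower, of the shifted chain.
Induction thus needs only the mean value inequality on `[0, 1]`; the factor `1 / p!` is given away.
-/
theorem taylor_chain_bound {p : ℕ} {g : ℕ → ℝ → ℝ} {M : ℝ}
    (hg : ∀ m < p, ∀ t ∈ Set.Icc (0 : ℝ) 1, HasDerivAt (g m) (g (m + 1) t) t)
    (hM : ∀ t ∈ Set.Icc (0 : ℝ) 1, |g p t| ≤ M) :
    ∀ t ∈ Set.Icc (0 : ℝ) 1,
      |g 0 t - ∑ m ∈ Finset.range p, g m 0 * t ^ m / (m.factorial : ℝ)| ≤ M := by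
  induction p generalizing g with
  | zero => simpa using hM
  | succ p ih =>
    have ih' := ih (g := fun m => g (m + 1)) (fun m hm => hg (m + 1) (by omega)) hM
    have hM0 : 0 ≤ M := (abs_nonneg _).trans (hM 0 (by simp))
    have hder : ∀ t ∈ Set.Icc (0 : ℝ) 1, HasDerivAt
        (fun t => g 0 t - ∑ m ∈ Finset.range (p + 1), g m 0 * t ^ m / (m.factorial : ℝ))
        (g 1 t - ∑ m ∈ Finset.range p, g (m + 1) 0 * t ^ m / (m.factorial : ℝ)) t := by
      intro t ht
      refine (hg 0 (by omega) t ht).sub ?_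
      have : ∀ m : ℕ, HasDerivAt (fun t : ℝ => g m 0 * t ^ m / (m.factorial : ℝ))
          (g m 0 * (m * t ^ (m - 1)) / (m.factorial : ℝ)) t := fun m =>
        ((hasDerivAt_pow m t).const_mul (g m 0)).div_const _
      have hs := HasDerivAt.fun_sum (u := Finset.range (p + 1)) fun m _ => this m
      convert hs using 1
      rw [Finset.sum_range_succ']
      simp only [Nat.cast_zero, zero_mul, mul_zero, zero_div, add_zero]
      refine Finset.sum_congr rfl fun m _ => ?_
      have h1 : ((m : ℝ) + 1) ≠ 0 := by positivity
      have h2 : (m.factorial : ℝ) ≠ 0 := by positivity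
      rw [Nat.factorial_succ, Nat.add_sub_cancel]
      push_cast
      field_simp
    intro t ht
    have hmv := Convex.norm_image_sub_le_of_norm_hasDerivWithin_le
      (fun s hs => (hder s hs).hasDerivWithinAt) (fun s hs => ih' s hs) (convex_Icc (0 : ℝ) 1)
      (Set.left_mem_Icc.2 zero_le_one) ht
    have h0 : g 0 0 - ∑ m ∈ Finset.range (p + 1), g m 0 * (0 : ℝ) ^ m / (m.factorial : ℝ) = 0 := by
      rw [Finset.sum_range_succ']
      simp
    rw [h0, sub_zero, sub_zero, Real.norm_eq_abs, Real.norm_eq_abs, abs_of_nonneg ht.1] at hmv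
    calc _ ≤ M * t := hmv
      _ ≤ M * 1 := by gcongr; exact ht.2
      _ = M := mul_one M

/-- The `m`-th derivative along the direction `h` of the member `α` of a family of functions
indexed by multi-indices, in which passing from `α` to `α + e_i` is differentiation. -/
def dirDeriv {d : ℕ} (h : E d) (c : (Fin d → ℕ) → ℝ) : ℕ → (Fin d → ℕ) → ℝ
  | 0, α => c α
  | m + 1, α => ∑ i, h i * dirDeriv h c m (α + Pi.single i 1)

theorem sum_add_single {d : ℕ} (α : Fin d → ℕ) (i : Fin d) :
    ∑ j, (α + Pi.single i 1 : Fin d → ℕ) j = ∑ j, α j + 1 := by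
  simp [Finset.sum_add_distrib]

theorem abs_dirDeriv_le {d : ℕ} {h : E d} {c : (Fin d → ℕ) → ℝ} {M l : ℝ} {p : ℕ}
    (hl : ∀ i, |h i| ≤ l) (hc : ∀ α : Fin d → ℕ, ∑ i, α i = p → |c α| ≤ M) :
    ∀ (m : ℕ) (α : Fin d → ℕ), ∑ i, α i + m = p → |dirDeriv h c m α| ≤ (d * l) ^ m * M := by
  intro m
  induction m with
  | zero => intro α hα; simpa [dirDeriv] using hc α (by simpa using hα)
  | succ m ih =>
    intro α hα
    rw [dirDeriv]
    -- Without a coordinate the sign of `l` is unknown, but then the sum is empty.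
    by_cases hd : d = 0
    · subst hd; simp
    have hl0 : 0 ≤ l := (abs_nonneg _).trans (hl ⟨0, by omega⟩)
    calc |∑ i, h i * dirDeriv h c m (α + Pi.single i 1)|
        ≤ ∑ i, |h i * dirDeriv h c m (α + Pi.single i 1)| := Finset.abs_sum_le_sum_abs _ _
      _ ≤ ∑ _i : Fin d, l * ((d * l) ^ m * M) := by
          refine Finset.sum_le_sum fun i _ => ?_
          rw [abs_mul]
          exact mul_le_mul (hl i) (ih _ (by rw [sum_add_single]; omega)) (abs_nonneg _) hl0
      _ = (d * l) ^ (m + 1) * M := by simp; ring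

/-- Makes the Taylor polynomial an honest polynomial of degree at most `q`, to which vanishing
moments apply. -/
theorem exists_polynomial_dirDeriv {d : ℕ} (z₀ : E d) (c : (Fin d → ℕ) → ℝ) (m : ℕ)
    (α : Fin d → ℕ) : ∃ P : MvPolynomial (Fin d) ℝ, P.totalDegree ≤ m ∧
      ∀ z : E d, MvPolynomial.eval (fun i => z i) P = dirDeriv (z - z₀) c m α := by
  induction m generalizing α with
  | zero => exact ⟨MvPolynomial.C (c α), by simp, fun z => by simp [dirDeriv]⟩
  | succ m ih =>
    choose P hP hPe using ih
    refine ⟨∑ i, (MvPolynomial.X i - MvPolynomial.C (z₀ i)) * P (α + Pi.single i 1), ?_, ?_⟩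
    · refine MvPolynomial.totalDegree_finsetSum_le fun i _ => ?_
      refine (MvPolynomial.totalDegree_mul _ _).trans ?_
      have h1 : (MvPolynomial.X i - MvPolynomial.C (z₀ i) :
          MvPolynomial (Fin d) ℝ).totalDegree ≤ 1 := by
        refine (MvPolynomial.totalDegree_sub _ _).trans ?_
        simp
      have := hP (α + Pi.single i 1)
      omega
    · intro z
      simp [dirDeriv, hPe]

theorem sum_mul_eval_eq_zero {d N q : ℕ} {x : Fin N → E d} {ω : Fin N → ℝ}
    (hω : ∀ α : Fin d → ℕ, ∑ i, α i ≤ q → moment x α ω = 0) {P : MvPolynomial (Fin d) ℝ}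
    (hP : P.totalDegree ≤ q) : ∑ a, ω a * MvPolynomial.eval (fun i => x a i) P = 0 := by
  simp only [MvPolynomial.eval_eq', Finset.mul_sum]
  rw [Finset.sum_comm]
  refine Finset.sum_eq_zero fun s hs => ?_
  have h1 : ∑ i, s i ≤ q := by
    refine le_trans (le_of_eq ?_) ((MvPolynomial.le_totalDegree hs).trans hP)
    rw [Finsupp.sum_fintype _ _ (fun _ => rfl)]
  have h2 := hω s h1
  rw [moment] at h2
  calc ∑ a, ω a * (MvPolynomial.coeff s P * ∏ i, x a i ^ s i)
      = MvPolynomial.coeff s P * ∑ a, ω a * ∏ i, x a i ^ s i := by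
        rw [Finset.mul_sum]
        exact Finset.sum_congr rfl fun a _ => by ring
    _ = 0 := by rw [h2, mul_zero]

/-- A functional with vanishing moments up to order `q`, applied to a function with `q + 1`
continuous partial derivatives. -/
theorem abs_sum_le_of_moment_eq_zero {d N q : ℕ} {x : Fin N → E d} {ω : Fin N → ℝ}
    {v : Finset (Fin N)} {U V : Set (E d)} {G : (Fin d → ℕ) → E d → ℝ} {M l : ℝ}
    (hω : ∀ α : Fin d → ℕ, ∑ i, α i ≤ q → moment x α ω = 0) (hv : ∀ a ∉ v, ω a = 0)
    (hU : IsOpen U) (hV : Convex ℝ V) (hVU : V ⊆ U) (hxV : ∀ a ∈ v, x a ∈ V)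
    (hl : ∀ z ∈ V, ∀ w ∈ V, ∀ i, |z i - w i| ≤ l)
    (hder : ∀ α : Fin d → ℕ, ∑ i, α i < q + 1 → ∀ i, ∀ z ∈ U,
      HasLineDerivAt ℝ (G α) (G (α + Pi.single i 1) z) z (EuclideanSpace.single i 1))
    (hcont : ∀ α : Fin d → ℕ, ∑ i, α i ≤ q + 1 → ContinuousOn (G α) U)
    (hM : ∀ α : Fin d → ℕ, ∑ i, α i = q + 1 → ∀ z ∈ V, |G α z| ≤ M) :
    |∑ a ∈ v, ω a * G 0 (x a)| ≤ (∑ a ∈ v, |ω a|) * ((d * l) ^ (q + 1) * M) := by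
  rcases v.eq_empty_or_nonempty with rfl | ⟨a₀, ha₀⟩
  · simp
  set z₀ := x a₀
  have hz₀ : z₀ ∈ V := hxV a₀ ha₀
  -- `P` is the Taylor polynomial of order `q` at the point `z₀` of the cluster.
  obtain ⟨P, hP, hPe⟩ : ∃ P : MvPolynomial (Fin d) ℝ, P.totalDegree ≤ q ∧ ∀ z : E d,
      MvPolynomial.eval (fun i => z i) P = ∑ m ∈ Finset.range (q + 1),
        dirDeriv (z - z₀) (fun α => G α z₀) m 0 / (m.factorial : ℝ) := by
    choose P hP hPe using fun m => exists_polynomial_dirDeriv z₀ (fun α => G α z₀) m 0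
    refine ⟨∑ m ∈ Finset.range (q + 1), MvPolynomial.C (1 / (m.factorial : ℝ)) * P m, ?_, ?_⟩
    · refine MvPolynomial.totalDegree_finsetSum_le fun m hm => ?_
      refine (MvPolynomial.totalDegree_mul _ _).trans ?_
      have := hP m
      have := Finset.mem_range.1 hm
      rw [MvPolynomial.totalDegree_C]
      omega
    · intro z
      rw [map_sum]
      refine Finset.sum_congr rfl fun m _ => ?_
      rw [map_mul, hPe, MvPolynomial.eval_C]
      ring
  have hTaylor : ∀ z ∈ V, |G 0 z - MvPolynomial.eval (fun i => z i) P|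
      ≤ (d * l) ^ (q + 1) * M := by
    intro z hz
    have hseg : ∀ t ∈ Set.Icc (0 : ℝ) 1, z₀ + t • (z - z₀) ∈ V := fun t ht =>
      hV.add_smul_sub_mem hz₀ hz ht
    -- Along the segment from `z₀` to `z`, the iterated directional derivatives form a chain as in
    -- `taylor_chain_bound`.
    have hdir : ∀ (m : ℕ) (α : Fin d → ℕ), ∑ i, α i + m < q + 1 → ∀ t ∈ Set.Icc (0 : ℝ) 1,
        HasDerivAt (fun t : ℝ => dirDeriv (z - z₀) (fun α => G α (z₀ + t • (z - z₀))) m α)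
          (dirDeriv (z - z₀) (fun α => G α (z₀ + t • (z - z₀))) (m + 1) α) t := by
      intro m
      induction m with
      | zero =>
        intro α hα t ht
        have h1 := hasLineDerivAt_of_partials hU (hder α (by simpa using hα))
          (fun i => hcont _ (by rw [sum_add_single]; omega)) (hVU (hseg t ht)) (z - z₀)
        have h2 : HasDerivAt (fun r : ℝ => r - t) 1 t := (hasDerivAt_id t).sub_const t
        have h1' : HasDerivAt (fun r : ℝ => G α (z₀ + t • (z - z₀) + r • (z - z₀)))
            (dirDeriv (z - z₀) (fun α => G α (z₀ + t • (z - z₀))) 1 α) (t - t) := by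
          rw [sub_self]; exact h1
        have h3 := HasDerivAt.scomp (h := fun r : ℝ => r - t) t h1' h2
        rw [one_smul] at h3
        refine h3.congr_of_eventuallyEq (.of_forall fun r => ?_)
        simp only [Function.comp, dirDeriv]
        rw [add_assoc, ← add_smul, add_sub_cancel]
      | succ m ih =>
        intro α hα t ht
        exact HasDerivAt.fun_sum fun i _ =>
          (ih (α + Pi.single i 1) (by rw [sum_add_single]; omega) t ht).const_mul _
    have h := taylor_chain_bound (p := q + 1) (M := (d * l) ^ (q + 1) * M)
      (g := fun m t => dirDeriv (z - z₀) (fun α => G α (z₀ + t • (z - z₀))) m 0)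
      (fun m hm t ht => hdir m 0 (by simpa using hm) t ht)
      (fun t ht => abs_dirDeriv_le (p := q + 1) (fun i => by simpa using hl z hz z₀ hz₀ i)
        (fun α hα => hM α hα _ (hseg t ht)) (q + 1) 0 (by simp))
      1 (by simp)
    rw [hPe]
    simpa [dirDeriv] using h
  have hzero : ∑ a ∈ v, ω a * MvPolynomial.eval (fun i => x a i) P = 0 := by
    rw [← sum_mul_eval_eq_zero hω hP]
    refine Finset.sum_subset (Finset.subset_univ v) fun a _ ha => ?_
    rw [hv a ha, zero_mul]
  calc |∑ a ∈ v, ω a * G 0 (x a)|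
      = |∑ a ∈ v, ω a * (G 0 (x a) - MvPolynomial.eval (fun i => x a i) P)| := by
        simp only [mul_sub, Finset.sum_sub_distrib, hzero, sub_zero]
    _ ≤ ∑ a ∈ v, |ω a * (G 0 (x a) - MvPolynomial.eval (fun i => x a i) P)| :=
        Finset.abs_sum_le_sum_abs _ _
    _ ≤ ∑ a ∈ v, |ω a| * ((d * l) ^ (q + 1) * M) := by
        refine Finset.sum_le_sum fun a ha => ?_
        rw [abs_mul]
        gcongr
        exact hTaylor _ (hxV a ha)
    _ = _ := by rw [Finset.sum_mul]

/-! ### Edges of bounding boxes -/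

section Boxes

variable {d N : ℕ} (x : Fin N → E d) {v w : Finset (Fin N)}

/-- The length of the longest edge of the bounding box. -/
noncomputable def longestEdge (v : Finset (Fin N)) : ℝ :=
  ⨆ i, (hi x v i - lo x v i)

theorem finite_image_coord (v : Finset (Fin N)) (i : Fin d) :
    ((fun a => x a i) '' (v : Set (Fin N))).Finite :=
  v.finite_toSet.image _

theorem lo_le {a : Fin N} (ha : a ∈ v) (i : Fin d) : lo x v i ≤ x a i :=
  csInf_le (finite_image_coord x v i).bddBelow ⟨a, ha, rfl⟩

theorem le_hi {a : Fin N} (ha : a ∈ v) (i : Fin d) : x a i ≤ hi x v i :=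
  le_csSup (finite_image_coord x v i).bddAbove ⟨a, ha, rfl⟩

theorem hi_le (hv : v.Nonempty) {i : Fin d} {c : ℝ} (h : ∀ a ∈ v, x a i ≤ c) : hi x v i ≤ c := by
  refine csSup_le ((Finset.coe_nonempty.2 hv).image _) ?_
  rintro _ ⟨a, ha, rfl⟩
  exact h a ha

theorem le_lo (hv : v.Nonempty) {i : Fin d} {c : ℝ} (h : ∀ a ∈ v, c ≤ x a i) : c ≤ lo x v i := by
  refine le_csInf ((Finset.coe_nonempty.2 hv).image _) ?_
  rintro _ ⟨a, ha, rfl⟩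
  exact h a ha

theorem mem_boundingBox {a : Fin N} (ha : a ∈ v) : x a ∈ boundingBox x v :=
  fun i => ⟨lo_le x ha i, le_hi x ha i⟩

theorem lo_le_hi (hv : v.Nonempty) (i : Fin d) : lo x v i ≤ hi x v i := by
  obtain ⟨a, ha⟩ := hv
  exact (lo_le x ha i).trans (le_hi x ha i)

theorem edge_mono (hv : v.Nonempty) (h : v ⊆ w) (i : Fin d) :
    hi x v i - lo x v i ≤ hi x w i - lo x w i :=
  sub_le_sub (hi_le x hv fun _ ha => le_hi x (h ha) i) (le_lo x hv fun _ ha => lo_le x (h ha) i)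

theorem edge_le_longestEdge (v : Finset (Fin N)) (i : Fin d) :
    hi x v i - lo x v i ≤ longestEdge x v :=
  le_ciSup (f := fun i => hi x v i - lo x v i) (Set.finite_range _).bddAbove i

theorem longestEdge_nonneg (hv : v.Nonempty) : 0 ≤ longestEdge x v :=
  Real.iSup_nonneg fun i => sub_nonneg.2 (lo_le_hi x hv i)

theorem longestEdge_pos (hx : Function.Injective x) (hv : v.Nontrivial) : 0 < longestEdge x v := by
  obtain ⟨a, ha, b, hb, hab⟩ := hv
  have hne : x a ≠ x b := fun h => hab (hx h)
  obtain ⟨i, hi'⟩ : ∃ i, x a i ≠ x b i := by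
    by_contra! h
    exact hne (by ext i; exact h i)
  have h1 := edge_le_longestEdge x v i
  have := lo_le x ha i
  have := lo_le x hb i
  have := le_hi x ha i
  have := le_hi x hb i
  rcases lt_or_gt_of_ne hi' with h | h <;> linarith

theorem convex_boundingBox (v : Finset (Fin N)) : Convex ℝ (boundingBox x v) := by
  intro z hz w hw s t hs ht hst i
  have hz := hz i
  have hw := hw i
  simp only [PiLp.add_apply, PiLp.smul_apply, smul_eq_mul]
  constructor
  · calc lo x v i = s * lo x v i + t * lo x v i := by rw [← add_mul, hst, one_mul]
      _ ≤ _ := by gcongr <;> tauto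
  · calc _ ≤ s * hi x v i + t * hi x v i := by gcongr <;> tauto
      _ = hi x v i := by rw [← add_mul, hst, one_mul]

theorem abs_sub_le_longestEdge {z z' : E d} (hz : z ∈ boundingBox x v)
    (hz' : z' ∈ boundingBox x v) (i : Fin d) : |z i - z' i| ≤ longestEdge x v := by
  have h1 := edge_le_longestEdge x v i
  have h2 := hz i
  have h3 := hz' i
  rw [abs_le]
  constructor <;> linarith

theorem isBounded_boundingBox (v : Finset (Fin N)) : Bornology.IsBounded (boundingBox x v) := by
  refine Metric.isBounded_iff.2 ⟨Real.sqrt (∑ _i : Fin d, longestEdge x v ^ 2), ?_⟩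
  intro z hz z' hz'
  rw [EuclideanSpace.dist_eq]
  refine Real.sqrt_le_sqrt (Finset.sum_le_sum fun i _ => ?_)
  rw [Real.dist_eq]
  gcongr
  exact abs_sub_le_longestEdge x hz hz' i

theorem longestEdge_le_diam (hv : v.Nonempty) : longestEdge x v ≤ Metric.diam (boundingBox x v) := by
  refine Real.iSup_le (fun i => ?_) Metric.diam_nonneg
  -- Two opposite corners of the box differ by the full edge in every coordinate.
  have h1 : WithLp.toLp 2 (hi x v) ∈ boundingBox x v := fun i => ⟨lo_le_hi x hv i, le_rfl⟩
  have h2 : WithLp.toLp 2 (lo x v) ∈ boundingBox x v := fun i => ⟨le_rfl, lo_le_hi x hv i⟩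
  refine le_trans ?_ (Metric.dist_le_diam_of_mem (isBounded_boundingBox x v) h1 h2)
  rw [dist_eq_norm]
  refine le_trans (le_abs_self _) ?_
  simpa using PiLp.norm_apply_le (WithLp.toLp 2 (hi x v) - WithLp.toLp 2 (lo x v) : E d) i

theorem setDist_le_dist {A B : Set (E d)} {z w : E d} (hz : z ∈ A) (hw : w ∈ B) :
    setDist A B ≤ dist z w :=
  csInf_le ⟨0, by rintro _ ⟨a, _, b, _, rfl⟩; exact dist_nonneg⟩ ⟨z, hz, w, hw, rfl⟩

variable {x}

theorem Admissible.symm {η : ℝ} (h : Admissible x η v w) : Admissible x η w v := by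
  have : setDist (boundingBox x w) (boundingBox x v)
      = setDist (boundingBox x v) (boundingBox x w) := by
    rw [setDist, setDist, Set.image2_swap]
    simp only [dist_comm]
  rw [Admissible, max_comm, this]
  exact h

/-- A common point makes the distance zero, while a cluster with two points has a box of positive
diameter. -/
theorem Admissible.disjoint {η : ℝ} (hη : 0 < η) (hx : Function.Injective x)
    (hv : v.Nontrivial) (h : Admissible x η v w) : Disjoint v w := by
  rw [Finset.disjoint_left]
  intro a ha ha'
  have h1 := setDist_le_dist (mem_boundingBox x ha) (mem_boundingBox x ha')
  rw [dist_self] at h1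
  have h2 : 0 < Metric.diam (boundingBox x v) :=
    (longestEdge_pos x hx hv).trans_le (longestEdge_le_diam x hv.nonempty)
  have h3 : 0 < η * max (Metric.diam (boundingBox x v)) (Metric.diam (boundingBox x w)) :=
    mul_pos hη (lt_max_of_lt_left h2)
  rw [Admissible] at h
  linarith

end Boxes

/-! ### Sums over the inner nodes of a cluster tree -/

section Trees

variable {d N : ℕ} {x : Fin N → E d}

/-- The sum of `g` over the clusters of all inner nodes. -/
def nodeSum (g : Finset (Fin N) → ℝ) : ClusterTree N → ℝ
  | .leaf _ => 0
  | .node left right =>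
      g (ClusterTree.node left right).cluster + nodeSum g left + nodeSum g right

theorem card_cluster_node {left right : ClusterTree N}
    (h : IsMedianSplit x left.cluster right.cluster) :
    (ClusterTree.node left right).cluster.card = left.cluster.card + right.cluster.card := by
  rw [ClusterTree.cluster, Finset.card_union_of_disjoint h.2.2.1]

/-- The least balanced split is into one and two points. -/
theorem IsMedianSplit.three_mul_card_le {v w : Finset (Fin N)} (h : IsMedianSplit x v w) :
    3 * v.card ≤ 2 * (v.card + w.card) ∧ 3 * w.card ≤ 2 * (v.card + w.card) := by
  obtain ⟨hv, hw, -, h1, h2, -⟩ := h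
  have := hv.card_pos
  have := hw.card_pos
  omega

/-- The right-hand side is a potential. At a split no edge grows and the cut edge is shared by the
sons, so the potential of the node exceeds that of its two sons by at least `|v| ℓ(v)`. -/
theorem nodeSum_card_mul_longestEdge_le {T : ClusterTree N} {τ : ℕ} (hT : IsBalancedTree x τ T)
    (hne : T.cluster.Nonempty) :
    nodeSum (fun v => v.card * longestEdge x v) T
      ≤ 3 * T.cluster.card * ∑ i, (hi x T.cluster i - lo x T.cluster i) := by
  induction T with
  | leaf v =>
    have : 0 ≤ ∑ i, (hi x v i - lo x v i) :=
      Finset.sum_nonneg fun i _ => sub_nonneg.2 (lo_le_hi x hne i)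
    simp only [nodeSum, ClusterTree.cluster]
    positivity
  | node left right ihl ihr =>
    obtain ⟨hs, hl, hr⟩ := hT
    have hcard := card_cluster_node hs
    obtain ⟨h3l, h3r⟩ := hs.three_mul_card_le
    obtain ⟨hnl, hnr, hdisj, -, -, l, hlong, hcut⟩ := hs
    have ihl := ihl hl hnl
    have ihr := ihr hr hnr
    set v := (ClusterTree.node left right).cluster
    set v₁ := left.cluster
    set v₂ := right.cluster
    have hs1 : v₁ ⊆ v := Finset.subset_union_left
    have hs2 : v₂ ⊆ v := Finset.subset_union_right
    have hlE : longestEdge x v = hi x v l - lo x v l := by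
      have : Nonempty (Fin d) := ⟨l⟩
      exact le_antisymm (ciSup_le fun i => hlong i) (edge_le_longestEdge x v l)
    have hsplit : (hi x v₁ l - lo x v₁ l) + (hi x v₂ l - lo x v₂ l) ≤ hi x v l - lo x v l := by
      have h1 : hi x v₂ l ≤ lo x v₁ l :=
        hi_le x hnr fun b hb => le_lo x hnl fun a ha => hcut a ha b hb
      have h2 : hi x v₁ l ≤ hi x v l := hi_le x hnl fun a ha => le_hi x (hs1 ha) l
      have h3 : lo x v l ≤ lo x v₂ l := le_lo x hnr fun a ha => lo_le x (hs2 ha) l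
      linarith
    have hsum : ∀ u : Finset (Fin N), u.Nonempty → u ⊆ v →
        ∑ i, (hi x u i - lo x u i) ≤ ∑ i, (hi x v i - lo x v i)
          - ((hi x v l - lo x v l) - (hi x u l - lo x u l)) := by
      intro u hu huv
      have h1 := Finset.add_sum_erase Finset.univ (fun i => hi x u i - lo x u i)
        (Finset.mem_univ l)
      have h2 := Finset.add_sum_erase Finset.univ (fun i => hi x v i - lo x v i)
        (Finset.mem_univ l)
      have h3 : ∑ i ∈ Finset.univ.erase l, (hi x u i - lo x u i)
          ≤ ∑ i ∈ Finset.univ.erase l, (hi x v i - lo x v i) :=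
        Finset.sum_le_sum fun i _ => edge_mono x hu huv i
      linarith
    have hsum1 := hsum v₁ hnl hs1
    have hsum2 := hsum v₂ hnr hs2
    set S := ∑ i, (hi x v i - lo x v i)
    set a := hi x v l - lo x v l
    set a₁ := hi x v₁ l - lo x v₁ l
    set a₂ := hi x v₂ l - lo x v₂ l
    have ha1 : 0 ≤ a₁ := sub_nonneg.2 (lo_le_hi x hnl l)
    have ha2 : 0 ≤ a₂ := sub_nonneg.2 (lo_le_hi x hnr l)
    have hn : (v.card : ℝ) = v₁.card + v₂.card := by exact_mod_cast hcard
    have h3l' : (v₁.card : ℝ) ≤ 2 * v₂.card := by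
      have : v₁.card ≤ 2 * v₂.card := by omega
      exact_mod_cast this
    have h3r' : (v₂.card : ℝ) ≤ 2 * v₁.card := by
      have : v₂.card ≤ 2 * v₁.card := by omega
      exact_mod_cast this
    set n₁ : ℝ := (v₁.card : ℝ)
    set n₂ : ℝ := (v₂.card : ℝ)
    have hn1 : 0 ≤ n₁ := Nat.cast_nonneg _
    have hn2 : 0 ≤ n₂ := Nat.cast_nonneg _
    have e1 : 3 * n₁ * (∑ i, (hi x v₁ i - lo x v₁ i)) ≤ 3 * n₁ * (S - (a - a₁)) := by gcongr
    have e2 : 3 * n₂ * (∑ i, (hi x v₂ i - lo x v₂ i)) ≤ 3 * n₂ * (S - (a - a₂)) := by gcongr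
    -- Each `nᵢ` is at least a third of `n₁ + n₂`, and `(a - a₁) + (a - a₂) ≥ a` because `a₁ + a₂ ≤
    -- a`.
    have e3 : (n₁ + n₂) * a ≤ 3 * (n₁ * (a - a₁) + n₂ * (a - a₂)) := by
      have f1 : 0 ≤ (2 * n₂ - n₁) * (a - a₂) := mul_nonneg (by linarith) (by linarith)
      have f2 : 0 ≤ (2 * n₁ - n₂) * (a - a₁) := mul_nonneg (by linarith) (by linarith)
      have f3 : 0 ≤ (n₁ + n₂) * (a - a₁ - a₂) := mul_nonneg (by linarith) (by linarith)
      nlinarith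
    calc nodeSum (fun v => v.card * longestEdge x v) (.node left right)
        = v.card * longestEdge x v + nodeSum (fun v => v.card * longestEdge x v) left
          + nodeSum (fun v => v.card * longestEdge x v) right := rfl
      _ ≤ (n₁ + n₂) * a + 3 * n₁ * (S - (a - a₁)) + 3 * n₂ * (S - (a - a₂)) := by
          rw [hlE, hn]; linarith
      _ ≤ 3 * v.card * S := by rw [hn]; linarith

theorem nodeSum_mono {g g' : Finset (Fin N) → ℝ} (h : ∀ v, g v ≤ g' v) (T : ClusterTree N) :
    nodeSum g T ≤ nodeSum g' T := by
  induction T with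
  | leaf v => exact le_rfl
  | node left right ihl ihr => exact add_le_add (add_le_add (h _) ihl) ihr

open Classical in
/-- The weighted cluster size `|v| ℓ(v)`, cut off at longest edges `ℓ(v) ≤ s`. -/
noncomputable def thresholdWeight (x : Fin N → E d) (s : ℝ) (v : Finset (Fin N)) : ℝ :=
  if v.Nonempty ∧ longestEdge x v ≤ s then v.card * longestEdge x v else 0

theorem thresholdWeight_of_le {s : ℝ} {v : Finset (Fin N)} (hv : v.Nonempty)
    (h : longestEdge x v ≤ s) : thresholdWeight x s v = v.card * longestEdge x v :=
  if_pos ⟨hv, h⟩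

theorem thresholdWeight_nonneg (x : Fin N → E d) (s : ℝ) (v : Finset (Fin N)) :
    0 ≤ thresholdWeight x s v := by
  unfold thresholdWeight
  split_ifs with h
  · exact mul_nonneg (Nat.cast_nonneg _) (longestEdge_nonneg x h.1)
  · exact le_rfl

theorem thresholdWeight_le {s : ℝ} (hs : 0 ≤ s) (v : Finset (Fin N)) :
    thresholdWeight x s v ≤ v.card * s := by
  unfold thresholdWeight
  split_ifs with h
  · exact mul_le_mul_of_nonneg_left h.2 (Nat.cast_nonneg _)
  · positivity

/-- Descend until the longest edge is at most `s`: longer nodes weigh nothing, and the bound is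
additive over disjoint sons. Where the descent stops, the potential bound applies with a sum of
edges at most `d s`. -/
theorem nodeSum_thresholdWeight_le {T : ClusterTree N} {τ : ℕ} (hT : IsBalancedTree x τ T)
    (hne : T.cluster.Nonempty) {s : ℝ} (hs : 0 ≤ s) :
    nodeSum (thresholdWeight x s) T ≤ 3 * d * s * T.cluster.card := by
  have hsmall : ∀ T : ClusterTree N, IsBalancedTree x τ T → T.cluster.Nonempty →
      longestEdge x T.cluster ≤ s →
      nodeSum (thresholdWeight x s) T ≤ 3 * d * s * T.cluster.card := by
    intro T hT hne hroot
    calc _ ≤ nodeSum (fun v => v.card * longestEdge x v) T := by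
          refine nodeSum_mono (fun v => ?_) T
          unfold thresholdWeight
          split_ifs with h
          · exact le_rfl
          · rcases v.eq_empty_or_nonempty with rfl | hv
            · simp
            · exact mul_nonneg (Nat.cast_nonneg _) (longestEdge_nonneg x hv)
      _ ≤ _ := nodeSum_card_mul_longestEdge_le hT hne
      _ ≤ 3 * T.cluster.card * ∑ _i : Fin d, s := by
          gcongr with i
          exact (edge_le_longestEdge x _ i).trans hroot
      _ = _ := by simp; ring
  induction T with
  | leaf v => simp only [nodeSum]; positivity
  | node left right ihl ihr =>
    by_cases hroot : longestEdge x (ClusterTree.node left right).cluster ≤ s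
    · exact hsmall _ hT hne hroot
    · obtain ⟨hsplit, hl, hr⟩ := hT
      have ihl := ihl hl hsplit.1
      have ihr := ihr hr hsplit.2.1
      have h0 : thresholdWeight x s (ClusterTree.node left right).cluster = 0 :=
        if_neg fun h => hroot h.2
      rw [nodeSum, h0, card_cluster_node hsplit]
      push_cast
      linarith

/-- A son has at most two thirds of the points, so `n log n` loses at least `log (3 / 2)` per point
at each split, which pays for the term `|v|`. -/
theorem nodeSum_card_le {T : ClusterTree N} {τ : ℕ} (hT : IsBalancedTree x τ T) :
    nodeSum (fun v => (v.card : ℝ)) T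
      ≤ (Real.log (3 / 2))⁻¹ * (T.cluster.card * Real.log T.cluster.card) := by
  have hlog : 0 < Real.log (3 / 2) := Real.log_pos (by norm_num)
  induction T with
  | leaf v =>
    have := Real.log_natCast_nonneg v.card
    simp only [nodeSum, ClusterTree.cluster]
    positivity
  | node left right ihl ihr =>
    obtain ⟨hs, hl, hr⟩ := hT
    have hcard := card_cluster_node hs
    obtain ⟨h3l, h3r⟩ := hs.three_mul_card_le
    have ihl := ihl hl
    have ihr := ihr hr
    have hp1 := hs.1.card_pos
    have hp2 := hs.2.1.card_pos
    rw [nodeSum, hcard]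
    generalize left.cluster.card = m₁ at *
    generalize right.cluster.card = m₂ at *
    set c := (Real.log (3 / 2))⁻¹ with hc
    have hc0 : 0 < c := inv_pos.2 hlog
    have hn1 : (0 : ℝ) < m₁ := by exact_mod_cast hp1
    have hn2 : (0 : ℝ) < m₂ := by exact_mod_cast hp2
    have hstep : ∀ m : ℕ, 0 < m → 3 * m ≤ 2 * (m₁ + m₂) →
        Real.log m ≤ Real.log (m₁ + m₂) - Real.log (3 / 2) := by
      intro m hm h
      have h' : (3 : ℝ) * m ≤ 2 * (m₁ + m₂) := by exact_mod_cast h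
      have hm' : (0 : ℝ) < m := by exact_mod_cast hm
      rw [← Real.log_div (by positivity) (by norm_num)]
      refine Real.log_le_log hm' ?_
      linarith
    have e1 := hstep m₁ hp1 h3l
    have e2 := hstep m₂ hp2 h3r
    have hcl : c * Real.log (3 / 2) = 1 := inv_mul_cancel₀ hlog.ne'
    push_cast
    set Λ := Real.log ((m₁ : ℝ) + m₂)
    have f1 : c * (m₁ * Real.log m₁) ≤ c * (m₁ * (Λ - Real.log (3 / 2))) := by gcongr
    have f2 : c * (m₂ * Real.log m₂) ≤ c * (m₂ * (Λ - Real.log (3 / 2))) := by gcongr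
    have f3 : (m₁ : ℝ) + m₂ + c * (m₁ * (Λ - Real.log (3 / 2)))
        + c * (m₂ * (Λ - Real.log (3 / 2))) = c * ((m₁ + m₂) * Λ) := by
      linear_combination (-(m₁ : ℝ) - m₂) * hcl
    linarith

end Trees

/-! ### Properties of samplets -/

section Samplets

variable {d N : ℕ} {x : Fin N → E d} {q : ℕ}

open Matrix

/-- A list of pairwise orthogonal unit vectors. -/
def IsOrthonormalList (L : List (Fin N → ℝ)) : Prop :=
  (∀ ω ∈ L, ω ⬝ᵥ ω = 1) ∧ L.Pairwise fun ω ω' => ω ⬝ᵥ ω' = 0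

theorem IsOrthonormalList.get_dotProduct {L : List (Fin N → ℝ)} (h : IsOrthonormalList L)
    (i j : Fin L.length) : L.get i ⬝ᵥ L.get j = if i = j then 1 else 0 := by
  have h2 := List.pairwise_iff_get.1 h.2
  rcases lt_trichotomy i j with hij | rfl | hij
  · rw [if_neg hij.ne, h2 i j hij]
  · rw [if_pos rfl]; exact h.1 _ (List.get_mem _ _)
  · rw [if_neg hij.ne', dotProduct_comm, h2 j i hij]

theorem IsOrthonormalList.sublist {L L' : List (Fin N → ℝ)} (h : IsOrthonormalList L)
    (hs : L'.Sublist L) : IsOrthonormalList L' :=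
  ⟨fun ω hω => h.1 ω (hs.subset hω), h.2.sublist hs⟩

theorem dotProduct_eq_zero_of_disjoint {v w : Finset (Fin N)} (h : Disjoint v w)
    {ω ω' : Fin N → ℝ} (hω : ∀ a ∉ v, ω a = 0) (hω' : ∀ a ∉ w, ω' a = 0) : ω ⬝ᵥ ω' = 0 := by
  refine Finset.sum_eq_zero fun a _ => ?_
  by_cases ha : a ∈ v
  · rw [hω' a (Finset.disjoint_left.1 h ha), mul_zero]
  · rw [hω a ha, zero_mul]

theorem IsOrthonormalList.append {L L' : List (Fin N → ℝ)} (h : IsOrthonormalList L)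
    (h' : IsOrthonormalList L') {v w : Finset (Fin N)} (hvw : Disjoint v w)
    (hv : ∀ ω ∈ L, ∀ a ∉ v, ω a = 0) (hw : ∀ ω ∈ L', ∀ a ∉ w, ω a = 0) :
    IsOrthonormalList (L ++ L') := by
  refine ⟨fun ω hω => ?_, List.pairwise_append.2 ⟨h.2, h'.2, fun ω hω ω' hω' =>
    dotProduct_eq_zero_of_disjoint hvw (hv ω hω) (hw ω' hω')⟩⟩
  rcases List.mem_append.1 hω with hω | hω
  · exact h.1 ω hω
  · exact h'.1 ω hω

theorem IsQRTransform.length_eq {L L' : List (Fin N → ℝ)} (h : IsQRTransform x q L L') :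
    L'.length = L.length := by
  obtain ⟨e, Q, R, -, -, -, rfl⟩ := h
  simp

theorem IsQRTransform.eq_zero {L L' : List (Fin N → ℝ)} (h : IsQRTransform x q L L')
    {a : Fin N} (ha : ∀ ω ∈ L, ω a = 0) : ∀ ω ∈ L', ω a = 0 := by
  obtain ⟨e, Q, R, -, -, -, rfl⟩ := h
  intro ω hω
  obtain ⟨c, rfl⟩ := (List.mem_ofFn' _ _).1 hω
  show (∑ i, Q i c • L.get i) a = 0
  rw [Finset.sum_apply]
  exact Finset.sum_eq_zero fun i _ => by
    rw [Pi.smul_apply, ha _ (List.get_mem _ _), smul_zero]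

/-- The Gram matrix becomes `Qᵀ Q = 1`. -/
theorem IsQRTransform.isOrthonormalList {L L' : List (Fin N → ℝ)} (h : IsQRTransform x q L L')
    (hL : IsOrthonormalList L) : IsOrthonormalList L' := by
  obtain ⟨e, Q, R, hQ, -, -, rfl⟩ := h
  have key : ∀ c c' : Fin L.length, (∑ i, Q i c • L.get i) ⬝ᵥ (∑ i, Q i c' • L.get i)
      = if c = c' then 1 else 0 := by
    intro c c'
    have h1 : Qᵀ * Q = 1 := by
      have := (mem_orthogonalGroup_iff' (Fin L.length) ℝ).1 hQ
      simpa [star_eq_conjTranspose] using this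
    have h2 := congrFun (congrFun h1 c) c'
    rw [mul_apply, one_apply] at h2
    rw [← h2, sum_dotProduct]
    refine Finset.sum_congr rfl fun i _ => ?_
    rw [dotProduct_sum]
    simp only [smul_dotProduct, dotProduct_smul, hL.get_dotProduct, smul_eq_mul]
    simp [mul_comm]
  refine ⟨fun ω hω => ?_, List.pairwise_ofFn.2 fun c c' hcc => ?_⟩
  · obtain ⟨c, rfl⟩ := (List.mem_ofFn' _ _).1 hω
    rw [key, if_pos rfl]
  · rw [key, if_neg hcc.ne]

/-- The moments of the new functionals are the rows of `Qᵀ Mᵀ = R`. From index `m_q` on, a row lies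
entirely below the diagonal of the triangular `R`, which has only `m_q` columns. -/
theorem IsQRTransform.moment_eq_zero {L L' : List (Fin N → ℝ)} (h : IsQRTransform x q L L')
    {ω : Fin N → ℝ} (hω : ω ∈ L'.drop (mq d q)) (α : Fin d → ℕ) (hα : ∑ i, α i ≤ q) :
    moment x α ω = 0 := by
  obtain ⟨e, Q, R, hQ, hR, hM, rfl⟩ := h
  obtain ⟨i, hi, rfl⟩ := List.mem_drop_iff_getElem.1 hω
  rw [List.length_ofFn] at hi
  rw [List.getElem_ofFn]
  set c : Fin L.length := ⟨mq d q + i, by omega⟩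
  have h1 : Qᵀ * Q = 1 := by
    have := (mem_orthogonalGroup_iff' (Fin L.length) ℝ).1 hQ
    simpa [star_eq_conjTranspose] using this
  have h2 : Qᵀ * (momentMatrix x e L)ᵀ = R := by
    rw [hM, ← Matrix.mul_assoc, h1, Matrix.one_mul]
  set r := e.symm ⟨α, hα⟩ with hr
  have h3 := congrFun (congrFun h2 c) r
  rw [hR c r (by have := r.2; simp only [c]; omega), mul_apply] at h3
  rw [← h3, moment]
  simp only [Finset.sum_apply, Pi.smul_apply, smul_eq_mul, Finset.sum_mul, transpose_apply,
    momentMatrix, of_apply, hr, Equiv.apply_symm_apply, moment, Finset.mul_sum]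
  rw [Finset.sum_comm]
  simp only [mul_assoc]

theorem SampletConstruction.scaling {T : ClusterTree N} {Φ : List (Fin N → ℝ)}
    {S : List (Finset (Fin N) × (Fin N → ℝ))} (h : SampletConstruction x q T Φ S)
    (hT : IsBalancedTree x (mq d q) T) :
    Φ.length ≤ mq d q ∧ IsOrthonormalList Φ ∧ ∀ ω ∈ Φ, ∀ a ∉ T.cluster, ω a = 0 := by
  induction h with
  | leaf v l hl hv =>
    subst hv
    refine ⟨?_, ⟨?_, ?_⟩, ?_⟩
    · rw [List.length_map, ← List.toFinset_card_of_nodup hl]; exact hT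
    · intro ω hω
      obtain ⟨a, -, rfl⟩ := List.mem_map.1 hω
      simp
    · rw [List.pairwise_map]
      refine hl.imp fun hab => ?_
      simp [hab]
    · intro ω hω a ha
      obtain ⟨b, hb, rfl⟩ := List.mem_map.1 hω
      rw [Pi.single_eq_of_ne]
      rintro rfl
      exact ha (List.mem_toFinset.2 hb)
  | node left right Φ₁ Φ₂ L S₁ S₂ h₁ h₂ hL ih₁ ih₂ =>
    obtain ⟨hs, hl, hr⟩ := hT
    obtain ⟨-, ho1, hz1⟩ := ih₁ hl
    obtain ⟨-, ho2, hz2⟩ := ih₂ hr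
    refine ⟨by simp, ?_, ?_⟩
    · exact (hL.isOrthonormalList (ho1.append ho2 hs.2.2.1 hz1 hz2)).sublist
        (List.take_sublist _ _)
    · intro ω hω a ha
      refine hL.eq_zero (fun ω' hω' => ?_) ω (List.mem_of_mem_take hω)
      rw [ClusterTree.cluster, Finset.mem_union, not_or] at ha
      rcases List.mem_append.1 hω' with h | h
      · exact hz1 _ h a ha.1
      · exact hz2 _ h a ha.2

/-- The functional `s.2` is a normalized samplet of order `q` of the cluster `s.1`. -/
structure IsSamplet (x : Fin N → E d) (q : ℕ) (s : Finset (Fin N) × (Fin N → ℝ)) : Prop where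
  nontrivial : s.1.Nontrivial
  norm : s.2 ⬝ᵥ s.2 = 1
  support : ∀ a ∉ s.1, s.2 a = 0
  moment : ∀ α : Fin d → ℕ, ∑ i, α i ≤ q → moment x α s.2 = 0

theorem IsMedianSplit.nontrivial {v w : Finset (Fin N)} (h : IsMedianSplit x v w) :
    (v ∪ w).Nontrivial := by
  rw [← Finset.one_lt_card_iff_nontrivial, Finset.card_union_of_disjoint h.2.2.1]
  have := h.1.card_pos
  have := h.2.1.card_pos
  omega

theorem SampletConstruction.isSamplet {T : ClusterTree N} {Φ : List (Fin N → ℝ)}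
    {S : List (Finset (Fin N) × (Fin N → ℝ))} (h : SampletConstruction x q T Φ S)
    (hT : IsBalancedTree x (mq d q) T) : ∀ s ∈ S, IsSamplet x q s := by
  induction h with
  | leaf v l hl hv => simp
  | node left right Φ₁ Φ₂ L S₁ S₂ h₁ h₂ hL ih₁ ih₂ =>
    obtain ⟨hs, hl, hr⟩ := hT
    obtain ⟨-, ho1, hz1⟩ := h₁.scaling hl
    obtain ⟨-, ho2, hz2⟩ := h₂.scaling hr
    intro s hsmem
    rcases List.mem_append.1 hsmem with h | h
    · rcases List.mem_append.1 h with h | h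
      · obtain ⟨ω, hω, rfl⟩ := List.mem_map.1 h
        have hωL := List.mem_of_mem_drop hω
        refine ⟨hs.nontrivial, ?_, ?_, ?_⟩
        · exact (hL.isOrthonormalList (ho1.append ho2 hs.2.2.1 hz1 hz2)).1 ω hωL
        · intro a ha
          refine hL.eq_zero (fun ω' hω' => ?_) ω hωL
          rw [ClusterTree.cluster, Finset.mem_union, not_or] at ha
          rcases List.mem_append.1 hω' with h | h
          · exact hz1 _ h a ha.1
          · exact hz2 _ h a ha.2
        · exact fun α hα => hL.moment_eq_zero hω α hα
      · exact ih₁ hl s h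
    · exact ih₂ hr s h

/-- Two sons hand over at most `2 m_q` scaling functions and `m_q` are retained, so a node provides
at most `m_q` samplets. -/
theorem SampletConstruction.sum_le {T : ClusterTree N} {Φ : List (Fin N → ℝ)}
    {S : List (Finset (Fin N) × (Fin N → ℝ))} (h : SampletConstruction x q T Φ S)
    (hT : IsBalancedTree x (mq d q) T) {g : Finset (Fin N) → ℝ} (hg : ∀ v, 0 ≤ g v) :
    (S.map fun s => g s.1).sum ≤ mq d q * nodeSum g T := by
  induction h with
  | leaf v l hl hv => simp [nodeSum]
  | node left right Φ₁ Φ₂ L S₁ S₂ h₁ h₂ hL ih₁ ih₂ =>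
    obtain ⟨hs, hl, hr⟩ := hT
    have hlen : (L.drop (mq d q)).length ≤ mq d q := by
      have := (h₁.scaling hl).1
      have := (h₂.scaling hr).1
      rw [List.length_drop, hL.length_eq, List.length_append]
      omega
    have hlen' : ((L.drop (mq d q)).length : ℝ) ≤ mq d q := by exact_mod_cast hlen
    rw [List.map_append, List.map_append, List.sum_append, List.sum_append, List.map_map, nodeSum]
    have e1 : ((L.drop (mq d q)).map ((fun s : Finset (Fin N) × (Fin N → ℝ) => g s.1) ∘
        fun ω => ((ClusterTree.node left right).cluster, ω))).sum
        = (L.drop (mq d q)).length * g (ClusterTree.node left right).cluster := by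
      simp [Function.comp_def]
    have e2 : ((L.drop (mq d q)).length : ℝ) * g (ClusterTree.node left right).cluster
        ≤ mq d q * g (ClusterTree.node left right).cluster :=
      mul_le_mul_of_nonneg_right hlen' (hg _)
    have := ih₁ hl
    have := ih₂ hr
    linarith

theorem sum_basis_le {T : ClusterTree N} {Φ : List (Fin N → ℝ)}
    {S : List (Finset (Fin N) × (Fin N → ℝ))} (h : SampletConstruction x q T Φ S)
    (hT : IsBalancedTree x (mq d q) T) {v : Fin N → Finset (Fin N)} {σ : Fin N → Fin N → ℝ}
    (hp : (List.ofFn fun j => (v j, σ j)).Perm (Φ.map (fun ω => (T.cluster, ω)) ++ S))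
    {g : Finset (Fin N) → ℝ} (hg : ∀ v, 0 ≤ g v) :
    ∑ j, g (v j) ≤ mq d q * (g T.cluster + nodeSum g T) := by
  have h1 := (hp.map fun s => g s.1).sum_eq
  rw [List.map_ofFn, List.sum_ofFn, List.map_append, List.sum_append, List.map_map] at h1
  have e1 : (Φ.map ((fun s : Finset (Fin N) × (Fin N → ℝ) => g s.1) ∘
      fun ω => (T.cluster, ω))).sum = Φ.length * g T.cluster := by
    simp [Function.comp_def]
  have hlen' : (Φ.length : ℝ) ≤ mq d q := by exact_mod_cast (h.scaling hT).1
  have e2 : (Φ.length : ℝ) * g T.cluster ≤ mq d q * g T.cluster :=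
    mul_le_mul_of_nonneg_right hlen' (hg _)
  have e3 := h.sum_le hT hg
  simp only [Function.comp] at h1 e1
  rw [h1, mul_add]
  linarith

end Samplets

/-! ### Entries of admissible pairs of clusters -/

section Entries

variable {d N q : ℕ} {x : Fin N → E d} {Ω : Set (E d)} {k : E d → E d → ℝ}
  {D : (Fin d → ℕ) → (Fin d → ℕ) → E d → E d → ℝ}

/-- The one-variable bound is used twice: in the first variable for each `∂_y^β k` with `|β| = q +
1`, then in the second variable for the sum over the first. This uses all `2(q + 1)` derivatives. -/
theorem IsPartials.abs_sum_sum_le (hD : IsPartials Ω (q + 1) k D) (hΩo : IsOpen Ω)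
    (hΩc : Convex ℝ Ω) (hxΩ : ∀ a, x a ∈ Ω) {c r δ : ℝ} (hc : 0 < c) (hr : 0 < r) (hδ : 0 < δ)
    (hb : ∀ α β : Fin d → ℕ, ∑ i, α i ≤ q + 1 → ∑ i, β i ≤ q + 1 →
      ∀ x ∈ Ω, ∀ y ∈ Ω, x ≠ y →
        |D α β x y| ≤ c * ((∑ i, (α i + β i)).factorial : ℝ)
          / (r * ‖x - y‖) ^ (∑ i, (α i + β i)))
    {s t : Finset (Fin N) × (Fin N → ℝ)} (hs : IsSamplet x q s) (ht : IsSamplet x q t)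
    (hdist : δ ≤ setDist (boundingBox x s.1) (boundingBox x t.1)) :
    |∑ a, ∑ b, s.2 a * t.2 b * k (x a) (x b)| ≤ (∑ a ∈ s.1, |s.2 a|) * (∑ b ∈ t.1, |t.2 b|) *
      ((d * longestEdge x s.1) ^ (q + 1) * (d * longestEdge x t.1) ^ (q + 1) *
        (c * ((2 * (q + 1)).factorial : ℝ) / (r * δ) ^ (2 * (q + 1)))) := by
  obtain ⟨v, ω⟩ := s
  obtain ⟨w, ω'⟩ := t
  have hω := hs.support
  have hω' := ht.support
  have hδd : ∀ z ∈ boundingBox x v, ∀ y ∈ boundingBox x w, δ ≤ dist z y := fun z hz y hy =>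
    hdist.trans (setDist_le_dist hz hy)
  have hne : ∀ z ∈ boundingBox x v, ∀ y ∈ boundingBox x w, z ≠ y := by
    rintro z hz y hy rfl
    have := hδd z hz z hy
    rw [dist_self] at this
    linarith
  set M₀ := c * ((2 * (q + 1)).factorial : ℝ) / (r * δ) ^ (2 * (q + 1)) with hM₀
  have hfst : ∀ β : Fin d → ℕ, ∑ i, β i = q + 1 → ∀ y ∈ Ω ∩ boundingBox x w,
      |∑ a ∈ v, ω a * D 0 β (x a) y|
        ≤ (∑ a ∈ v, |ω a|) * ((d * longestEdge x v) ^ (q + 1) * M₀) := by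
    intro β hβ y hy
    -- Differentiation takes place on the open set off the singularity, Taylor expansion on the
    -- convex set `Ω ∩ B_v`, which the positive distance of the boxes keeps away from `y`.
    refine abs_sum_le_of_moment_eq_zero (U := Ω \ {y}) (V := Ω ∩ boundingBox x v)
      (G := fun α z => D α β z y) hs.moment hω (hΩo.sdiff isClosed_singleton)
      (hΩc.inter (convex_boundingBox x v)) ?_ ?_ ?_ ?_ ?_ ?_
    · exact fun z hz => ⟨hz.1, hne z hz.2 y hy.2⟩
    · exact fun a ha => ⟨hxΩ a, mem_boundingBox x ha⟩
    · exact fun z hz z' hz' i => abs_sub_le_longestEdge x hz.2 hz'.2 i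
    · exact fun α hα i z hz => hD.fst α β hα hβ.le i z hz.1 y hy.1 hz.2
    · intro α hα
      exact (hD.cont α β hα hβ.le).comp (f := fun z => (z, y)) (by fun_prop)
        fun z hz => ⟨hz.1, hy.1, hz.2⟩
    · intro α hα z hz
      have hsum : ∑ i, (α i + β i) = 2 * (q + 1) := by
        rw [Finset.sum_add_distrib, hα, hβ, two_mul]
      refine (hb α β hα.le hβ.le z hz.1 y hy.1 (hne z hz.2 y hy.2)).trans ?_
      rw [hsum, hM₀]
      gcongr
      rw [← dist_eq_norm]
      exact hδd z hz.2 y hy.2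
  have hsnd : |∑ b ∈ w, ω' b * ∑ a ∈ v, ω a * D 0 0 (x a) (x b)|
      ≤ (∑ b ∈ w, |ω' b|) * ((d * longestEdge x w) ^ (q + 1) *
        ((∑ a ∈ v, |ω a|) * ((d * longestEdge x v) ^ (q + 1) * M₀))) := by
    refine abs_sum_le_of_moment_eq_zero (U := Ω \ (x '' (v : Set (Fin N))))
      (V := Ω ∩ boundingBox x w) (G := fun β y => ∑ a ∈ v, ω a * D 0 β (x a) y) ht.moment hω'
      (hΩo.sdiff (v.finite_toSet.image x).isClosed)
      (hΩc.inter (convex_boundingBox x w)) ?_ ?_ ?_ ?_ ?_ hfst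
    · rintro y hy
      refine ⟨hy.1, ?_⟩
      rintro ⟨a, ha, rfl⟩
      exact hne _ (mem_boundingBox x ha) _ hy.2 rfl
    · exact fun a ha => ⟨hxΩ a, mem_boundingBox x ha⟩
    · exact fun z hz z' hz' i => abs_sub_le_longestEdge x hz.2 hz'.2 i
    · intro β hβ i y hy
      refine HasDerivAt.fun_sum fun a ha => HasDerivAt.const_mul _ ?_
      exact hD.snd 0 β (by simp) hβ i (x a) (hxΩ a) y hy.1 fun h => hy.2 ⟨a, ha, h⟩
    · intro β hβ
      refine continuousOn_finsetSum _ fun a ha => continuousOn_const.mul ?_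
      exact (hD.cont 0 β (by simp) hβ).comp (f := fun y => (x a, y)) (by fun_prop)
        fun y hy => ⟨hxΩ a, hy.1, fun h => hy.2 ⟨a, ha, h⟩⟩
  have hswap : ∑ a, ∑ b, ω a * ω' b * k (x a) (x b)
      = ∑ b ∈ w, ω' b * ∑ a ∈ v, ω a * D 0 0 (x a) (x b) := by
    rw [Finset.sum_comm, ← Finset.sum_subset (Finset.subset_univ w)]
    · refine Finset.sum_congr rfl fun b hb => ?_
      rw [← Finset.sum_subset (Finset.subset_univ v), Finset.mul_sum]
      · refine Finset.sum_congr rfl fun a ha => ?_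
        rw [hD.zero _ (hxΩ a) _ (hxΩ b) (hne _ (mem_boundingBox x ha) _ (mem_boundingBox x hb))]
        ring
      · intro a _ ha
        rw [show ω a = 0 from hω a ha]; ring
    · intro b _ hb
      refine Finset.sum_eq_zero fun a _ => ?_
      rw [show ω' b = 0 from hω' b hb]; ring
  simp only
  rw [hswap]
  refine hsnd.trans (le_of_eq ?_)
  ring

/-- Cauchy-Schwarz on the support of a unit vector. -/
theorem IsSamplet.sq_sum_abs_le {s : Finset (Fin N) × (Fin N → ℝ)} (hs : IsSamplet x q s) :
    (∑ a ∈ s.1, |s.2 a|) ^ 2 ≤ s.1.card := by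
  refine sq_sum_le_card_mul_sum_sq.trans ?_
  have h1 : ∑ a ∈ s.1, |s.2 a| ^ 2 ≤ 1 := by
    rw [← hs.norm, dotProduct]
    refine (Finset.sum_le_univ_sum_of_nonneg fun a => by positivity).trans (le_of_eq ?_)
    exact Finset.sum_congr rfl fun a _ => by rw [sq_abs, sq]
  calc (s.1.card : ℝ) * ∑ a ∈ s.1, |s.2 a| ^ 2 ≤ s.1.card * 1 := by gcongr
    _ = _ := mul_one _

/-- The squared entry decays with the ratio of the edge lengths of the two clusters. -/
theorem exists_sq_entry_le (hΩo : IsOpen Ω) (hΩc : Convex ℝ Ω)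
    (hk : IsAsymptoticallySmooth Ω (q + 1) k) : ∃ K > (0 : ℝ), ∀ (N : ℕ) (x : Fin N → E d),
      Function.Injective x → (∀ a, x a ∈ Ω) → ∀ η : ℝ, 0 < η →
      ∀ s t : Finset (Fin N) × (Fin N → ℝ), IsSamplet x q s → IsSamplet x q t →
      Admissible x η s.1 t.1 →
      (∑ a, ∑ b, s.2 a * t.2 b * k (x a) (x b)) ^ 2 ≤ (K * (η ^ (2 * (q + 1)))⁻¹) ^ 2 *
        (s.1.card * t.1.card * (min (longestEdge x s.1) (longestEdge x t.1) /
          max (longestEdge x s.1) (longestEdge x t.1))) := by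
  obtain ⟨D, hD, c, hc, r, hr, hb⟩ := hk
  -- The summand `1` keeps the constant positive also for `d = 0`.
  refine ⟨(d : ℝ) ^ (2 * (q + 1)) * c * ((2 * (q + 1)).factorial : ℝ) / r ^ (2 * (q + 1)) + 1,
    by positivity, ?_⟩
  intro N x hx hxΩ η hη s t hs ht hadm
  have hl' : 0 < longestEdge x s.1 := longestEdge_pos x hx hs.nontrivial
  have hm' : 0 < longestEdge x t.1 := longestEdge_pos x hx ht.nontrivial
  have hprod := min_mul_max (longestEdge x s.1) (longestEdge x t.1)
  have hratio := min_le_max (a := longestEdge x s.1) (b := longestEdge x t.1)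
  have hl := lt_min hl' hm'
  have hm := hl.trans_le hratio
  have hδ : η * max (longestEdge x s.1) (longestEdge x t.1)
      ≤ setDist (boundingBox x s.1) (boundingBox x t.1) := by
    refine le_trans ?_ hadm
    gcongr
    · exact longestEdge_le_diam x hs.nontrivial.nonempty
    · exact longestEdge_le_diam x ht.nontrivial.nonempty
  have h1 := hD.abs_sum_sum_le hΩo hΩc hxΩ hc hr (mul_pos hη hm) hb hs ht hδ
  rw [← mul_pow _ (d * longestEdge x t.1), mul_mul_mul_comm (d : ℝ), ← hprod] at h1
  set l := min (longestEdge x s.1) (longestEdge x t.1)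
  set m := max (longestEdge x s.1) (longestEdge x t.1)
  set A := ∑ a ∈ s.1, |s.2 a|
  set B := ∑ a ∈ t.1, |t.2 a|
  have hA : A ^ 2 ≤ s.1.card := hs.sq_sum_abs_le
  have hB : B ^ 2 ≤ t.1.card := ht.sq_sum_abs_le
  set K₀ := (d : ℝ) ^ (2 * (q + 1)) * c * ((2 * (q + 1)).factorial : ℝ) / r ^ (2 * (q + 1))
  have hK₀ : 0 ≤ K₀ := by positivity
  have hratio' : l / m ≤ 1 := (div_le_one hm).2 hratio
  have hratio0 : 0 ≤ l / m := by positivity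
  have h2 : (d * d * (l * m) : ℝ) ^ (q + 1) *
        (c * ((2 * (q + 1)).factorial : ℝ) / (r * (η * m)) ^ (2 * (q + 1)))
      = K₀ * (η ^ (2 * (q + 1)))⁻¹ * (l / m) ^ (q + 1) := by
    simp only [K₀, mul_pow, div_pow, two_mul, pow_add]
    field_simp
  rw [h2] at h1
  calc (∑ a, ∑ b, s.2 a * t.2 b * k (x a) (x b)) ^ 2
      ≤ (A * B * (K₀ * (η ^ (2 * (q + 1)))⁻¹ * (l / m) ^ (q + 1))) ^ 2 := by
        rw [← sq_abs]
        gcongr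
    _ = (K₀ * (η ^ (2 * (q + 1)))⁻¹) ^ 2 * (A ^ 2 * B ^ 2 * (l / m) ^ (2 * q + 1 + 1)) := by
        ring
    _ ≤ ((K₀ + 1) * (η ^ (2 * (q + 1)))⁻¹) ^ 2 * (s.1.card * t.1.card * (l / m)) := by
        gcongr
        · linarith
        · exact pow_le_of_le_one hratio0 hratio' (by omega)

end Entries

/-! ### The compression error -/

section Compression

variable {d N q : ℕ} {x : Fin N → E d}

theorem frobeniusNorm_sq (A : Matrix (Fin N) (Fin N) ℝ) :
    frobeniusNorm A ^ 2 = ∑ i, ∑ j, A i j ^ 2 := by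
  have h0 : 0 ≤ ∑ i, ∑ j, A i j ^ 2 :=
    Finset.sum_nonneg fun i _ => Finset.sum_nonneg fun j _ => sq_nonneg _
  have h1 : frobeniusNorm A = Real.sqrt (∑ i, ∑ j, A i j ^ 2) := by
    rw [frobeniusNorm, Matrix.frobenius_norm_def, Real.sqrt_eq_rpow]
    simp
  rw [h1, Real.sq_sqrt h0]

/-- The sum over all pairs of clusters of a samplet basis, the first with the shorter edge, of the
cluster sizes weighted by the ratio of the edges. -/
theorem sum_sum_thresholdWeight_le {T : ClusterTree N} {v : Fin N → Finset (Fin N)}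
    {σ : Fin N → Fin N → ℝ} (hroot : T.cluster = Finset.univ)
    (hT : IsBalancedTree x (mq d q) T) (hB : IsSampletBasis x q T v σ)
    (hpos : ∀ j, 0 < longestEdge x (v j)) (hN : 0 < N) :
    ∑ j, ∑ j', thresholdWeight x (longestEdge x (v j')) (v j) *
        ((v j').card / longestEdge x (v j'))
      ≤ mq d q * (1 + 3 * d) * N *
        (mq d q * (N + (Real.log (3 / 2))⁻¹ * (N * Real.log N))) := by
  obtain ⟨Φ, S, hc, hp⟩ := hB
  have hcard : (T.cluster.card : ℝ) = N := by rw [hroot]; simp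
  have hne : T.cluster.Nonempty := by
    rw [hroot]; exact ⟨⟨0, hN⟩, Finset.mem_univ _⟩
  -- In `1 + 3 d` the `1` stems from the scaling functions of the root, the `3 d` from the samplets.
  have h1 : ∀ s : ℝ, 0 ≤ s →
      ∑ j, thresholdWeight x s (v j) ≤ mq d q * ((1 + 3 * d) * N * s) := by
    intro s hs
    refine (sum_basis_le hc hT hp (thresholdWeight_nonneg x s)).trans ?_
    have e1 := thresholdWeight_le (x := x) hs T.cluster
    have e2 := nodeSum_thresholdWeight_le hT hne hs
    rw [hcard] at e1 e2
    gcongr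
    linarith
  have h2 : ∑ j, ((v j).card : ℝ)
      ≤ mq d q * (N + (Real.log (3 / 2))⁻¹ * (N * Real.log N)) := by
    refine (sum_basis_le hc hT hp (g := fun v => (v.card : ℝ)) fun v => Nat.cast_nonneg _).trans ?_
    have e2 := nodeSum_card_le hT
    rw [hcard] at e2
    rw [hcard]
    gcongr
  rw [Finset.sum_comm]
  calc _ = ∑ j', (∑ j, thresholdWeight x (longestEdge x (v j')) (v j)) *
        ((v j').card / longestEdge x (v j')) := by simp only [Finset.sum_mul]
    _ ≤ ∑ j', (mq d q * ((1 + 3 * d) * N * longestEdge x (v j'))) *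
        ((v j').card / longestEdge x (v j')) := by
        gcongr with j'
        · exact div_nonneg (Nat.cast_nonneg _) (hpos j').le
        · exact h1 _ (hpos j').le
    -- The longest edge of `v j'`, being the threshold, cancels.
    _ = mq d q * (1 + 3 * d) * N * ∑ j', ((v j').card : ℝ) := by
        rw [Finset.mul_sum]
        refine Finset.sum_congr rfl fun j' _ => ?_
        have := (hpos j').ne'
        field_simp
    _ ≤ _ := by gcongr

end Compression

end Samplet

theorem theorem4p3p5 {d : ℕ} (hd : 1 ≤ d) (Ω : Set (Samplet.E d)) (hΩo : IsOpen Ω)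
    (hΩc : Convex ℝ Ω) (q : ℕ) (k : Samplet.E d → Samplet.E d → ℝ)
    (hk : Samplet.IsAsymptoticallySmooth Ω (q + 1) k) (C₁ : ℝ) (hC₁ : 0 < C₁) :
    ∃ C > (0 : ℝ), ∀ (N : ℕ), 2 ≤ N → ∀ (x : Fin N → Samplet.E d),
      Function.Injective x → (∀ a, x a ∈ Ω) →
      C₁ * (N : ℝ) ^ (-(1 / (d : ℝ))) ≤ Samplet.separationRadius x →
      ∀ (T : Samplet.ClusterTree N), T.cluster = Finset.univ →
      Samplet.IsBalancedTree x (Samplet.mq d q) T →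
      ∀ (v : Fin N → Finset (Fin N)) (σ : Fin N → Fin N → ℝ),
      Samplet.IsSampletBasis x q T v σ →
      ∀ η : ℝ, 0 < η →
        Samplet.frobeniusNorm (Samplet.sampletKernelMatrix x k σ
            - Samplet.compressedMatrix x k η v σ)
          ≤ C * η ^ (-(2 * ((q : ℤ) + 1))) * (N : ℝ) * Real.sqrt (Real.log (N : ℝ)) := by
  obtain ⟨K, hK, hentry⟩ := Samplet.exists_sq_entry_le hΩo hΩc hk
  set m : ℝ := (Samplet.mq d q : ℝ)
  have hlog32 : 0 < Real.log (3 / 2) := Real.log_pos (by norm_num)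
  have hlog2 : 0 < Real.log 2 := Real.log_pos (by norm_num)
  -- The `2` accounts for the two orders of edge lengths in a pair; `(log 2)⁻¹` absorbs `N` into `N
  -- log N`, as `N ≥ 2`.
  set A : ℝ := 2 * (m * (1 + 3 * d) * (m * ((Real.log 2)⁻¹ + (Real.log (3 / 2))⁻¹))) with hA
  have hm : 0 < m := Nat.cast_pos.2 (Nat.choose_pos (Nat.le_add_left d q))
  have hA0 : 0 < A := by positivity
  refine ⟨K * Real.sqrt A, by positivity, ?_⟩
  intro N hN x hx hxΩ _ T hroot hT v σ hB η hη
  have hNpos : 0 < N := by omega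
  have hlogN : Real.log 2 ≤ Real.log N := Real.log_le_log (by norm_num) (by exact_mod_cast hN)
  have hclass : ∀ j, v j = Finset.univ ∨ Samplet.IsSamplet x q (v j, σ j) := by
    obtain ⟨Φ, S, hc, hp⟩ := hB
    intro j
    have hmem := hp.subset (List.mem_ofFn.2 ⟨j, rfl⟩)
    rcases List.mem_append.1 hmem with h | h
    · obtain ⟨ω, -, h⟩ := List.mem_map.1 h
      left
      rw [← hroot]
      exact (congrArg Prod.fst h).symm
    · exact Or.inr (hc.isSamplet hT _ h)
  have hnontriv : ∀ j, (v j).Nontrivial := by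
    intro j
    rcases hclass j with h | h
    · rw [h, ← Finset.one_lt_card_iff_nontrivial, Finset.card_univ, Fintype.card_fin]
      omega
    · exact h.nontrivial
  have hpos : ∀ j, 0 < Samplet.longestEdge x (v j) := fun j =>
    Samplet.longestEdge_pos x hx (hnontriv j)
  -- Admissible clusters are disjoint, which excludes the root and with it the scaling functions,
  -- whose moments need not vanish.
  have hsamplet : ∀ j j', Samplet.Admissible x η (v j) (v j') →
      Samplet.IsSamplet x q (v j, σ j) := by
    intro j j' hadm
    refine (hclass j).resolve_left fun h => ?_
    have := hadm.disjoint hη hx (hnontriv j)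
    obtain ⟨a, ha⟩ := (hnontriv j').nonempty
    rw [h] at this
    exact Finset.disjoint_left.1 this (Finset.mem_univ a) ha
  set W : Fin N → Fin N → ℝ := fun j j' =>
    Samplet.thresholdWeight x (Samplet.longestEdge x (v j')) (v j) *
      ((v j').card / Samplet.longestEdge x (v j')) with hW
  have hW0 : ∀ j j', 0 ≤ W j j' := fun j j' =>
    mul_nonneg (Samplet.thresholdWeight_nonneg _ _ _)
      (div_nonneg (Nat.cast_nonneg _) (hpos j').le)
  set P : ℝ := K * (η ^ (2 * (q + 1)))⁻¹ with hP
  have hbound : ∀ j j', Samplet.Admissible x η (v j) (v j') →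
      (∑ a, ∑ b, σ j a * σ j' b * k (x a) (x b)) ^ 2 ≤ P ^ 2 * (W j j' + W j' j) := by
    intro j j' hadm
    refine (hentry N x hx hxΩ η hη (v j, σ j) (v j', σ j') (hsamplet j j' hadm)
      (hsamplet j' j hadm.symm) hadm).trans ?_
    refine mul_le_mul_of_nonneg_left ?_ (sq_nonneg P)
    -- Whichever cluster has the shorter edge, one of the two terms equals the entry bound and the
    -- other is nonnegative.
    rcases le_total (Samplet.longestEdge x (v j)) (Samplet.longestEdge x (v j')) with h | h
    · refine le_trans (le_of_eq ?_) (le_add_of_nonneg_right (hW0 j' j))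
      simp only [hW]
      rw [Samplet.thresholdWeight_of_le (hnontriv j).nonempty h, min_eq_left h, max_eq_right h]
      ring
    · refine le_trans (le_of_eq ?_) (le_add_of_nonneg_left (hW0 j j'))
      simp only [hW]
      rw [Samplet.thresholdWeight_of_le (hnontriv j').nonempty h, min_eq_right h, max_eq_left h]
      ring
  have hle : ∀ j j', (Samplet.sampletKernelMatrix x k σ
      - Samplet.compressedMatrix x k η v σ) j j' ^ 2 ≤ P ^ 2 * (W j j' + W j' j) := by
    intro j j'
    rw [Matrix.sub_apply, Samplet.compressedMatrix, Matrix.of_apply]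
    split_ifs with hadm
    · rw [sub_zero, Samplet.sampletKernelMatrix, Matrix.of_apply]
      exact hbound j j' hadm
    · rw [sub_self, zero_pow two_ne_zero]
      exact mul_nonneg (sq_nonneg P) (add_nonneg (hW0 j j') (hW0 j' j))
  have hsum : ∑ j, ∑ j', P ^ 2 * (W j j' + W j' j) ≤ P ^ 2 * (A * (N ^ 2 * Real.log N)) := by
    have h1 := Samplet.sum_sum_thresholdWeight_le hroot hT hB hpos hNpos
    have h2 : ∑ j, ∑ j', (W j j' + W j' j) = 2 * ∑ j, ∑ j', W j j' := by
      simp only [Finset.sum_add_distrib]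
      rw [Finset.sum_comm (f := fun j j' => W j' j), two_mul]
    have h3 : (N : ℝ) ≤ (Real.log 2)⁻¹ * (N * Real.log N) := by
      rw [inv_mul_eq_div, le_div_iff₀ hlog2]
      gcongr
    simp only [← Finset.mul_sum]
    rw [h2]
    refine mul_le_mul_of_nonneg_left ?_ (sq_nonneg P)
    calc 2 * ∑ j, ∑ j', W j j'
        ≤ 2 * (m * (1 + 3 * d) * N * (m * (N + (Real.log (3 / 2))⁻¹ * (N * Real.log N)))) := by
          gcongr
      _ ≤ 2 * (m * (1 + 3 * d) * N * (m * ((Real.log 2)⁻¹ * (N * Real.log N)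
            + (Real.log (3 / 2))⁻¹ * (N * Real.log N)))) := by
          gcongr
      _ = A * (N ^ 2 * Real.log N) := by rw [hA]; ring
  have hηp : η ^ (-(2 * ((q : ℤ) + 1))) = (η ^ (2 * (q + 1)))⁻¹ := by
    rw [zpow_neg, ← zpow_natCast]
    push_cast
    rfl
  have hlogN0 : 0 ≤ Real.log N := hlog2.le.trans hlogN
  rw [hηp]
  refine le_of_sq_le_sq ?_ (by positivity)
  rw [Samplet.frobeniusNorm_sq]
  refine (Finset.sum_le_sum fun j _ => Finset.sum_le_sum fun j' _ => hle j j').trans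
    (hsum.trans (le_of_eq ?_))
  simp only [mul_pow, hP]
  rw [Real.sq_sqrt hA0.le, Real.sq_sqrt hlogN0]
  ring
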